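/- Let $k\ge 2$ be such that $T_k(x)=x^k+x+1$ is primitive over $\mathbb F_2$, i.e. $T_k$ is irreducible and the class of $x$ in $\mathbb F_2[x]/(T_k)$ has multiplicative order $2^k-1$. Let $F:\{0,1\}^k\to\{0,1\}^k$, $F(x_0,\dots,x_{k-1})=(x_1,\dots,x_{k-1},x_0\oplus x_1)$, be the successor map of the linear-feedback shift register with characteristic polynomial $T_k$. Join the cycle of the $m$-sequence with the all-zero cycle at the conjugate pair $(0^k,10^{k-1})$: let $F'$ be the map obtained from $F$ by interchanging the images of these two states, i.e. $F'(0^k)=F(10^{k-1})=0^{k-1}1$, $F'(10^{k-1})=F(0^k)=0^k$ and $F'(x)=F(x)$ for all other states $x$. For any seed $x_0\in\{0,1\}^k$, let $s_t$ be the first entry of the state $F'^{\,t}(x_0)$, and let $M_k$ be the word obtained from $s_0s_1\cdots s_{2^k-1}$ by reversing it and complementing every bit (the choice of the seed corresponds to the choice of a rotation of the cyclic word $M_k$). For a word $w$, let $\mathrm{cBWT}(w)$ be the last column of the matrix whose rows are the $|w|$ cyclic rotations of $w$ in lexicographic order (with $0<1$); a run is a maximal block of equal letters. Then, for every seed, $M_k$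 is a binary de Bruijn sequence of order $k$ (it has length $2^k$ and every word in $\{0,1\}^k$ occurs exactly once as a cyclic window), $$\mathrm{cBWT}(M_k)=1\,(0011)^{2^{k-2}-1}\,010,$$ and $\mathrm{cBWT}(M_k)$ has exactly $2^{k-1}+2$ runs. This is run-minimal: for every binary de Bruijn sequence $w$ of order $k$, $\mathrm{cBWT}(w)$ has at least $2^{k-1}+2$ runs. -/

import Mathlib

open Polynomial

/-! ### Words, the circular Burrows–Wheeler transform, runs, de Bruijn sequences -/

/-- The alphabet `{0, 1}` is `ZMod 2`, with `0 < 1`. -/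
instance instLinearOrderBit : LinearOrder (ZMod 2) :=
  inferInstanceAs (LinearOrder (Fin 2))

/-- The `|w|` cyclic rotations of `w` (with multiplicity), by the cut positions `0, …, |w| - 1`. -/
def rotations {α : Type*} (w : List α) : List (List α) :=
  (List.range w.length).map fun c => w.rotate c

/-- The circular Burrows–Wheeler transform: sort the rotations of `w` lexicographically and read
off the last column (for `w` nonempty every row is nonempty, so that every row contributes its
last letter). -/
def cBWT {α : Type*} [LinearOrder α] (w : List α) : List α :=
  ((rotations w).mergeSort fun u v => decide (u ≤ v)).filterMap List.getLast?

/-- The number of runs, i.e. of maximal blocks of equal letters. -/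
def numRuns {α : Type*} [DecidableEq α] (w : List α) : ℕ :=
  (w.splitBy fun a b => a == b).length

/-- `w`, read cyclically, is a de Bruijn sequence of order `k` over the alphabet `α`: it has length
`|α| ^ k`, and every word `v` of length `k` occurs at exactly one position as a cyclic window. -/
def IsDeBruijn {α : Type*} [Fintype α] (k : ℕ) (w : List α) : Prop :=
  w.length = Fintype.card α ^ k ∧
    ∀ v : Fin k → α, ∃! c : Fin w.length,
      ∀ i : Fin k, w[((c : ℕ) + (i : ℕ)) % w.length]? = some (v i)

/-- The complement of a binary word (exchange `0` and `1`). -/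
def complementWord (w : List (ZMod 2)) : List (ZMod 2) :=
  w.map fun a => a + 1

/-! ### Linear-feedback shift registers and cycle joining -/

/-- A polynomial `C` over `𝔽₂` of degree `d` is primitive if it is irreducible and the class of `x`
in `𝔽₂[x] / (C)` has multiplicative order `2 ^ d - 1`. -/
def IsPrimitiveBinary (C : (ZMod 2)[X]) : Prop :=
  Irreducible C ∧ orderOf (AdjoinRoot.root C) = 2 ^ C.natDegree - 1

/-- The trinomial `x ^ k + x + 1` over `𝔽₂`. -/
noncomputable def trinomial2 (k : ℕ) : (ZMod 2)[X] := X ^ k + X + 1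

/-- States of a binary shift register of length `k`. -/
abbrev RegState (k : ℕ) := Fin k → ZMod 2

/-- The successor map of the shift register with characteristic polynomial
`C = x ^ k + c_{k-1} x ^ (k-1) + ⋯ + c_0`:
`(x_0, …, x_{k-1}) ↦ (x_1, …, x_{k-1}, ∑ c_i x_i)`. -/
noncomputable def lfsrSucc (k : ℕ) (C : (ZMod 2)[X]) (x : RegState k) : RegState k :=
  fun i => if h : (i : ℕ) + 1 < k then x ⟨(i : ℕ) + 1, h⟩ else ∑ j : Fin k, C.coeff (j : ℕ) * x j

/-- Cycle joining: the states `u` and `v` interchange their successors under `F`. -/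
def joinCycles {S : Type*} [DecidableEq S] (F : S → S) (u v : S) : S → S :=
  fun x => if x = u then F v else if x = v then F u else F x

/-- The state `0 ^ k`. -/
def zeroState (k : ℕ) : RegState k := fun _ => 0

/-- The state `1 0 ^ (k-1)`. -/
def oneZerosState (k : ℕ) : RegState k := fun i => if (i : ℕ) = 0 then 1 else 0

/-- The word `s_0 s_1 ⋯ s_{n-1}` put out by the register with successor map `F` and seed `x₀`, where
`s_t` is the first entry of the state at time `t`. -/
def outputWord {k : ℕ} (hk : 0 < k) (F : RegState k → RegState k) (n : ℕ) (x₀ : RegState k) :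
    List (ZMod 2) :=
  List.ofFn fun t : Fin n => (F^[(t : ℕ)] x₀) ⟨0, hk⟩

/-- One period (of length `2 ^ k`), from the seed `x₀`, of the sequence that arises from the shift
register of `x ^ k + x + 1` by joining the cycle of `1 0 ^ (k-1)` with the all-zero cycle at the
conjugate pair `(0 ^ k, 1 0 ^ (k-1))`. -/
noncomputable def joinedWord {k : ℕ} (hk : 2 ≤ k) (x₀ : RegState k) : List (ZMod 2) :=
  outputWord (Nat.lt_of_lt_of_le Nat.zero_lt_two hk)
    (joinCycles (lfsrSucc k (trinomial2 k)) (zeroState k) (oneZerosState k)) (2 ^ k) x₀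

/-- The word `M_k`: the joined sequence, reversed and complemented. As a cyclic word it does not
depend on the seed `x₀`, which only selects the rotation. -/
noncomputable def wordM {k : ℕ} (hk : 2 ≤ k) (x₀ : RegState k) : List (ZMod 2) :=
  complementWord (joinedWord hk x₀).reverse

/-- The word `1 (0011) ^ (2 ^ (k-2) - 1) 010` (for `k ≥ 2`). -/
def runMinimalPattern (k : ℕ) : List (ZMod 2) :=
  [1] ++ (List.replicate (2 ^ (k - 2) - 1) [0, 0, 1, 1]).flatten ++ [0, 1, 0]

/-! ### Counting runs. -/

section Runs

variable {α : Type*}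

/-! The rotations of a de Bruijn sequence begin with all words of length `k`, once each, so the
transform lists the letters that precede these words, in lexicographic order of the words
(`IsDeBruijn.cBWT_eq_map`).

Lower bound: `v0` and `v1` have different preceding letters, so the transform consists of `2 ^ (k -
1)` blocks `01` or `10` and has at least `2 ^ (k - 1) + 1` runs. Equality forces the blocks to
alternate; their number is even, so the first and the last would differ. But `0 ^ k` is preceded by
`1` and `1 ^ k` by `0`, so both are `10`.

Construction: primitivity puts all nonzero states of the register on one cycle (`lfsr_reachable`),
and the join inserts `0 ^ k` (`joinCycles_reachable`). Reversal turns the feedback `x_0 + x_1` into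
a rule giving the preceding letter from the last two letters of the window. In lexicographic order
this rule repeats `1001`; the join alters only the last two values, giving a final `1010`. -/

theorem length_splitBy_loop (r : α → α → Bool) (l : List α) (a : α) (g : List α)
    (gs : List (List α)) :
    (List.splitBy.loop r l a g gs).length = gs.length + (List.splitBy.loop r l a [] []).length := by
  induction l generalizing a g gs with
  | nil => simp [List.splitBy.loop]
  | cons b l ih =>
    simp only [List.splitBy.loop]
    split
    · rw [ih b (a :: g) gs, ih b [a] []]
      simp
    · rw [ih b [] _, ih b [] [_]]
      simp
      omega

variable [DecidableEq α]

theorem numRuns_singleton (a : α) : numRuns [a] = 1 := rfl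

theorem numRuns_cons_cons (a b : α) (l : List α) :
    numRuns (a :: b :: l) = numRuns (b :: l) + if a = b then 0 else 1 := by
  unfold numRuns
  simp only [List.splitBy, List.splitBy.loop]
  by_cases h : a = b
  · simp only [h, beq_self_eq_true, if_true, Nat.add_zero]
    rw [length_splitBy_loop]
    simp
  · have : (a == b) = false := by simpa using h
    simp only [this, h, if_false]
    rw [length_splitBy_loop]
    simp
    omega

end Runs

theorem bit_eq_add_one_iff_ne {a b : ZMod 2} : a = b + 1 ↔ a ≠ b := by
  revert a b; decide

/-- Blocks `b (b + 1)` produce at least one run per block, plus one; equality forces the first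
letters of the blocks to alternate. -/
theorem numRuns_flatMap_blocks (b : ZMod 2) (l : List (ZMod 2)) :
    l.length + 2 ≤ numRuns ((b :: l).flatMap fun b => [b, b + 1]) ∧
      (numRuns ((b :: l).flatMap fun b => [b, b + 1]) = l.length + 2 →
        (b :: l).getLast (by simp) = b + l.length) := by
  induction l generalizing b with
  | nil =>
    have h : b ≠ b + 1 := by revert b; decide
    simp [numRuns_cons_cons, numRuns_singleton, h]
  | cons c l ih =>
    obtain ⟨h₁, h₂⟩ := ih c
    have h : b ≠ b + 1 := by revert b; decide
    simp only [List.flatMap_cons, List.cons_append, List.nil_append, List.length_cons] at h₁ h₂ ⊢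
    rw [numRuns_cons_cons, if_neg h, numRuns_cons_cons]
    refine ⟨by omega, fun hr => ?_⟩
    -- No run starts at the junction of two blocks exactly when the next block begins with `b + 1`.
    split at hr
    · rename_i hbc
      rw [List.getLast_cons (by simp), h₂ (by omega), ← hbc]
      push_cast
      ring
    · omega

theorem numRuns_runMinimalPattern {k : ℕ} (hk : 2 ≤ k) :
    numRuns (runMinimalPattern k) = 2 ^ (k - 1) + 2 := by
  -- Each factor `0011` adds two runs to the four of `1010`.
  have key : ∀ m : ℕ, numRuns ((1 : ZMod 2) ::
      ((List.replicate m [(0 : ZMod 2), 0, 1, 1]).flatten ++ [0, 1, 0])) = 2 * m + 4 := by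
    intro m
    induction m with
    | zero => decide
    | succ m ih =>
      simp only [List.replicate_succ, List.flatten_cons, List.cons_append, List.nil_append]
      rw [numRuns_cons_cons, numRuns_cons_cons, numRuns_cons_cons, numRuns_cons_cons, ih]
      simp
      omega
  have := key (2 ^ (k - 2) - 1)
  obtain ⟨j, rfl⟩ := Nat.exists_eq_add_of_le hk
  have h2 : 0 < 2 ^ j := by positivity
  simp only [runMinimalPattern, List.cons_append, List.nil_append,
    show 2 + j - 2 = j by omega, show 2 + j - 1 = j + 1 by omega] at this ⊢
  rw [this, pow_succ]
  omega

/-! ### Binary words in lexicographic order. -/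

section Words

/-- All binary words of length `n` in lexicographic order. -/
def binaryWords : ℕ → List (List (ZMod 2))
  | 0 => [[]]
  | n + 1 => (binaryWords n).flatMap fun v => [v ++ [0], v ++ [1]]

theorem mem_binaryWords {n : ℕ} {v : List (ZMod 2)} : v ∈ binaryWords n ↔ v.length = n := by
  induction n generalizing v with
  | zero => simp [binaryWords]
  | succ n ih =>
    simp only [binaryWords, List.mem_flatMap, ih]
    constructor
    · rintro ⟨u, hu, h⟩
      simp only [List.mem_cons, List.not_mem_nil, or_false] at h
      rcases h with rfl | rfl <;> simp [hu]
    · intro h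
      have hv : v ≠ [] := by rintro rfl; simp at h
      refine ⟨v.dropLast, by simp [h], ?_⟩
      have hb : ∀ b : ZMod 2, b = 0 ∨ b = 1 := by decide
      have hd := List.dropLast_append_getLast hv
      rcases hb (v.getLast hv) with h0 | h0 <;> rw [h0] at hd <;> simp [hd]

theorem length_binaryWords (n : ℕ) : (binaryWords n).length = 2 ^ n := by
  induction n with
  | zero => rfl
  | succ n ih => simp [binaryWords, ih, pow_succ]

theorem lex_append_of_lt {u v x y : List (ZMod 2)} (hl : u.length = v.length) (h : u < v) :
    u ++ x < v ++ y := by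
  induction u generalizing v with
  | nil =>
    cases v with
    | nil => exact absurd h (lt_irrefl _)
    | cons => simp at hl
  | cons a u ih =>
    cases v with
    | nil => simp at hl
    | cons b v =>
      rw [List.cons_append, List.cons_append, List.cons_lt_cons_iff]
      rcases List.cons_lt_cons_iff.1 h with h | ⟨h, h'⟩
      · exact .inl h
      · exact .inr ⟨h, ih (by simpa using hl) h'⟩

theorem pairwise_binaryWords (n : ℕ) : (binaryWords n).Pairwise (· < ·) := by
  induction n with
  | zero => simp [binaryWords]
  | succ n ih =>
    rw [binaryWords, List.pairwise_flatMap]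
    constructor
    · intro v _
      have : v ++ [0] < v ++ [(1 : ZMod 2)] := List.append_left_lt (by decide)
      simpa using this
    · refine ih.imp_of_mem fun {u v} hu hv h x hx y hy => ?_
      rw [mem_binaryWords] at hu hv
      simp only [List.mem_cons, List.not_mem_nil, or_false] at hx hy
      rcases hx with rfl | rfl <;> rcases hy with rfl | rfl <;>
        exact lex_append_of_lt (hu.trans hv.symm) h

theorem nodup_binaryWords (n : ℕ) : (binaryWords n).Nodup :=
  (pairwise_binaryWords n).imp fun h => ne_of_lt h

theorem head?_binaryWords (n : ℕ) : (binaryWords n).head? = some (List.replicate n 0) := by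
  induction n with
  | zero => rfl
  | succ n ih =>
    cases h : binaryWords n with
    | nil => simp [h] at ih
    | cons u l =>
      rw [h] at ih
      simp_all [binaryWords, List.replicate_succ']

theorem exists_binaryWords_eq_append (n : ℕ) :
    ∃ l, binaryWords n = l ++ [List.replicate n 1] := by
  induction n with
  | zero => exact ⟨[], rfl⟩
  | succ n ih =>
    obtain ⟨l, hl⟩ := ih
    exact ⟨(l.flatMap fun v => [v ++ [0], v ++ [1]]) ++ [List.replicate n 1 ++ [0]],
      by simp [binaryWords, hl, List.replicate_succ']⟩

/-- Keeps the sorted rotations sorted after truncation to length `k`. -/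
theorem take_le_take {α : Type*} [LinearOrder α] (n : ℕ) {u v : List α} (h : u ≤ v) :
    u.take n ≤ v.take n := by
  induction n generalizing u v with
  | zero => simp
  | succ n ih =>
    cases u with
    | nil => exact not_lt.1 (List.not_lt_nil _)
    | cons a u =>
      cases v with
      | nil => exact absurd h (not_le_of_gt List.Lex.nil)
      | cons b v =>
        simp only [List.take_succ_cons]
        rcases h.lt_or_eq with h | h
        · rcases List.cons_lt_cons_iff.1 h with h' | ⟨rfl, h'⟩
          · exact le_of_lt (List.Lex.rel h')
          · exact List.cons_le_cons _ (ih (le_of_lt h'))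
        · rw [List.cons.injEq] at h
          rw [h.1, h.2]

end Words

/-! ### Windows of de Bruijn sequences and the lower bound. -/

section DeBruijn

variable {k : ℕ} {w : List (ZMod 2)}

/-- The cyclic window of length `k` of `w` at position `c`. -/
def cyclicWindow (k : ℕ) (w : List (ZMod 2)) (c : ℕ) : List (ZMod 2) := (w.rotate c).take k

theorem cyclicWindow_mod (c : ℕ) : cyclicWindow k w (c % w.length) = cyclicWindow k w c := by
  rw [cyclicWindow, List.rotate_mod, cyclicWindow]

theorem IsDeBruijn.length_eq (h : IsDeBruijn k w) : w.length = 2 ^ k := by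
  simpa using h.1

theorem IsDeBruijn.lt_length (h : IsDeBruijn k w) : k < w.length := by
  rw [h.length_eq]; exact Nat.lt_two_pow_self

theorem length_cyclicWindow (h : k ≤ w.length) (c : ℕ) : (cyclicWindow k w c).length = k := by
  simp [cyclicWindow, h]

theorem cyclicWindow_eq_iff (h : k ≤ w.length) (c : ℕ) (v : Fin k → ZMod 2) :
    cyclicWindow k w c = List.ofFn v ↔
      ∀ i : Fin k, w[(c + (i : ℕ)) % w.length]? = some (v i) := by
  rw [List.ext_getElem?_iff]
  have key : ∀ i : Fin k, (cyclicWindow k w c)[(i : ℕ)]? = w[(c + (i : ℕ)) % w.length]? := by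
    intro i
    rw [cyclicWindow, List.getElem?_take_of_lt i.2, List.getElem?_rotate (by omega), add_comm]
  constructor
  · intro H i
    rw [← key, H]
    simp
  · intro H i
    by_cases hi : i < k
    · rw [key ⟨i, hi⟩, H ⟨i, hi⟩]
      simp [hi]
    · rw [List.getElem?_eq_none (by rw [length_cyclicWindow h]; omega),
        List.getElem?_eq_none (by simp; omega)]

theorem IsDeBruijn.exists_cyclicWindow (h : IsDeBruijn k w) {v : List (ZMod 2)}
    (hv : v.length = k) : ∃ c < w.length, cyclicWindow k w c = v := by
  subst hv
  obtain ⟨c, hc, -⟩ := h.2 v.get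
  exact ⟨c, c.2, by rw [(cyclicWindow_eq_iff h.lt_length.le c v.get).2 hc, List.ofFn_get]⟩

theorem IsDeBruijn.mod_eq_of_cyclicWindow_eq (h : IsDeBruijn k w) {c d : ℕ}
    (he : cyclicWindow k w c = cyclicWindow k w d) : c % w.length = d % w.length := by
  have hpos : 0 < w.length := by have := h.lt_length; omega
  have hlen := length_cyclicWindow h.lt_length.le c
  have hex : ∃ v : Fin k → ZMod 2, cyclicWindow k w c = List.ofFn v :=
    ⟨fun i => (cyclicWindow k w c)[(i : ℕ)], by apply List.ext_getElem <;> simp [hlen]⟩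
  obtain ⟨v, hv⟩ := hex
  obtain ⟨e, -, he'⟩ := h.2 v
  have h1 := he' ⟨c % w.length, Nat.mod_lt _ hpos⟩
    ((cyclicWindow_eq_iff h.lt_length.le _ v).1 (by rw [cyclicWindow_mod, hv]))
  have h2 := he' ⟨d % w.length, Nat.mod_lt _ hpos⟩
    ((cyclicWindow_eq_iff h.lt_length.le _ v).1 (by rw [cyclicWindow_mod, ← he, hv]))
  simpa using h1.trans h2.symm

theorem IsDeBruijn.map_take_rotations_perm (h : IsDeBruijn k w) :
    ((rotations w).map (List.take k)).Perm (binaryWords k) := by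
  rw [rotations, List.map_map]
  refine (List.perm_ext_iff_of_nodup ?_ (nodup_binaryWords k)).2 fun v => ?_
  · refine List.Nodup.map_on ?_ List.nodup_range
    intro c hc d hd hcd
    rw [List.mem_range] at hc hd
    simpa [Nat.mod_eq_of_lt, hc, hd] using h.mod_eq_of_cyclicWindow_eq hcd
  · rw [mem_binaryWords, List.mem_map]
    constructor
    · rintro ⟨c, -, rfl⟩
      exact length_cyclicWindow h.lt_length.le c
    · intro hv
      obtain ⟨c, hc, hcv⟩ := h.exists_cyclicWindow hv
      exact ⟨c, List.mem_range.2 hc, hcv⟩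

/-- If the letter preceding each window of length `k` is given by `g`, then the transform of a de
Bruijn sequence lists the values of `g` on all words in lexicographic order. -/
theorem IsDeBruijn.cBWT_eq_map (h : IsDeBruijn k w) (g : List (ZMod 2) → ZMod 2)
    (hg : ∀ c, (w.rotate c).getLast? = some (g (cyclicWindow k w c))) :
    cBWT w = (binaryWords k).map g := by
  set L := (rotations w).mergeSort fun u v => decide (u ≤ v) with hL
  have hperm : L.Perm (rotations w) := List.mergeSort_perm _ _
  have hsort : L.Pairwise (· ≤ ·) := by
    have := List.pairwise_mergeSort (le := fun u v : List (ZMod 2) => decide (u ≤ v))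
      (fun a b c h₁ h₂ => by simpa using le_trans (by simpa using h₁) (by simpa using h₂))
      (fun a b => by simpa using le_total a b) (rotations w)
    exact this.imp fun h => by simpa using h
  have hmap : L.map (List.take k) = binaryWords k := by
    refine List.Perm.eq_of_pairwise (le := (· ≤ ·)) (fun a b _ _ => le_antisymm)
      (hsort.map _ fun u v huv => take_le_take k huv)
      ((pairwise_binaryWords k).imp fun h => le_of_lt h)
      ((hperm.map _).trans h.map_take_rotations_perm)
  have hlast : ∀ l : List (List (ZMod 2)), (∀ u ∈ l, u.getLast? = some (g (u.take k))) →
      l.filterMap List.getLast? = (l.map (List.take k)).map g := by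
    intro l hl
    induction l with
    | nil => rfl
    | cons u l ih =>
      rw [List.filterMap_cons_some (hl u (by simp)), ih fun u hu => hl u (by simp [hu])]
      rfl
  rw [cBWT, ← hL, hlast L, hmap]
  intro u hu
  obtain ⟨c, -, rfl⟩ := List.mem_map.1 (hperm.mem_iff.1 hu)
  exact hg c

/-- A window determines its position modulo the length, hence the letter before it. -/
theorem IsDeBruijn.exists_preceding (h : IsDeBruijn k w) : ∃ g : List (ZMod 2) → ZMod 2,
    ∀ c, (w.rotate c).getLast? = some (g (cyclicWindow k w c)) := by
  have hpos : 0 < w.length := by have := h.lt_length; omega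
  refine ⟨fun v => ((w.rotate (Function.invFun (cyclicWindow k w) v)).getLast?).getD 0, fun c => ?_⟩
  have hc := Function.invFun_eq (f := cyclicWindow k w) ⟨c, rfl⟩
  have := h.mod_eq_of_cyclicWindow_eq hc
  dsimp only
  rw [← List.rotate_mod w (Function.invFun _ _), this, List.rotate_mod]
  cases hx : (w.rotate c).getLast? with
  | some a => rfl
  | none =>
    rw [List.getLast?_eq_none_iff, List.rotate_eq_nil_iff] at hx
    simp [hx] at hpos

theorem cyclicWindow_succ_eq_cons (hk : k < w.length) (c : ℕ) {a : ZMod 2}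
    (ha : (w.rotate (c + 1)).getLast? = some a) :
    cyclicWindow (k + 1) w c = a :: cyclicWindow k w (c + 1) := by
  unfold cyclicWindow
  rw [← List.rotate_rotate] at ha ⊢
  have hlen : (w.rotate c).length = w.length := List.length_rotate ..
  cases hx : w.rotate c with
  | nil => rw [hx] at hlen; simp at hlen; omega
  | cons b l =>
    rw [hx] at hlen ha
    simp only [List.length_cons] at hlen
    simp at ha
    simp [ha, List.take_append_of_le_length (show k ≤ l.length by omega)]

theorem IsDeBruijn.two_pow_add_two_le_numRuns (hk : 2 ≤ k) (h : IsDeBruijn k w) :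
    2 ^ (k - 1) + 2 ≤ numRuns (cBWT w) := by
  obtain ⟨g, hg⟩ := h.exists_preceding
  rw [h.cBWT_eq_map g hg]
  obtain ⟨k, rfl⟩ : ∃ n, k = n + 1 := ⟨k - 1, by omega⟩
  have hkw : k + 1 < w.length := h.lt_length
  have hpred : ∀ v : List (ZMod 2), v.length = k → ∀ b, ∃ c,
      cyclicWindow (k + 1) w (c + 1) = v ++ [b] ∧
      cyclicWindow (k + 1) w c = g (v ++ [b]) :: v := by
    intro v hv b
    obtain ⟨c, -, hc⟩ := h.exists_cyclicWindow (v := v ++ [b]) (by simp [hv])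
    -- Adding a full turn before stepping back covers `c = 0`.
    have hc' : cyclicWindow (k + 1) w (c + w.length - 1 + 1) = v ++ [b] := by
      rw [show c + w.length - 1 + 1 = c + w.length by omega, ← cyclicWindow_mod,
        Nat.add_mod_right, cyclicWindow_mod, hc]
    refine ⟨c + w.length - 1, hc', ?_⟩
    rw [cyclicWindow_succ_eq_cons (by omega) _ (hg _), hc']
    congr 1
    have := congrArg (List.take k) hc'
    simpa [cyclicWindow, List.take_take, hv] using this
  -- With equal preceding letters, `v0` and `v1` would both follow the same window, which occurs
  -- only once.
  have hne : ∀ v : List (ZMod 2), v.length = k → g (v ++ [1]) = g (v ++ [0]) + 1 := by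
    intro v hv
    rw [bit_eq_add_one_iff_ne]
    intro he
    obtain ⟨c, hc, hc'⟩ := hpred v hv 1
    obtain ⟨d, hd, hd'⟩ := hpred v hv 0
    have hcd := h.mod_eq_of_cyclicWindow_eq (hc'.trans (by rw [he, hd']))
    rw [← cyclicWindow_mod, Nat.add_mod, hcd, ← Nat.add_mod, cyclicWindow_mod, hd] at hc
    simp at hc
  -- Otherwise the constant window would occur at two consecutive positions.
  have hrep : ∀ b : ZMod 2, g (List.replicate k b ++ [b]) = b + 1 := by
    intro b
    rw [bit_eq_add_one_iff_ne]
    intro he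
    obtain ⟨c, hc, hc'⟩ := hpred (List.replicate k b) (by simp) b
    rw [he, ← List.replicate_succ] at hc'
    rw [← List.replicate_succ'] at hc
    have := h.mod_eq_of_cyclicWindow_eq (hc.trans hc'.symm)
    have h1 : (c + 1) ≡ c + 0 [MOD w.length] := this
    have := Nat.ModEq.add_left_cancel' c h1
    rw [Nat.ModEq, Nat.mod_eq_of_lt (by omega), Nat.zero_mod] at this
    omega
  have hmap : (binaryWords (k + 1)).map g =
      ((binaryWords k).map fun v => g (v ++ [0])).flatMap fun b => [b, b + 1] := by
    have : ∀ l : List (List (ZMod 2)), (∀ v ∈ l, v.length = k) →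
        (l.flatMap fun v => [v ++ [0], v ++ [1]]).map g =
          (l.map fun v => g (v ++ [0])).flatMap fun b => [b, b + 1] := by
      intro l hl
      induction l with
      | nil => rfl
      | cons v l ih =>
        simp [hne v (hl v (by simp)), ih fun v hv => hl v (by simp [hv])]
    exact this _ fun v hv => mem_binaryWords.1 hv
  rw [hmap]
  have hhead := head?_binaryWords k
  obtain ⟨m, hm⟩ := exists_binaryWords_eq_append k
  have hlen := length_binaryWords k
  have hlast : (binaryWords k).getLast? = some (List.replicate k 1) := by simp [hm]
  cases hB : binaryWords k with
  | nil => rw [hB] at hhead; simp at hhead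
  | cons u l =>
    rw [hB] at hhead hlen hlast
    obtain ⟨h₁, h₂⟩ := numRuns_flatMap_blocks (g (u ++ [0])) (l.map fun v => g (v ++ [0]))
    simp only [List.length_map, List.length_cons] at h₁ h₂ hlen
    rw [List.map_cons, Nat.add_sub_cancel]
    by_contra hlt
    have hr := h₂ (by omega)
    simp only [List.head?_cons, Option.some.injEq] at hhead
    rw [hhead, hrep 0] at hr
    have hl1 : g (List.replicate k 1 ++ [0]) = 1 := by
      have h1 := hrep 1
      rw [hne _ (by simp)] at h1
      generalize g (List.replicate k 1 ++ [0]) = x at h1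
      revert x; decide
    have hlast' : (g (List.replicate k 0 ++ [0]) :: l.map fun v => g (v ++ [0])).getLast?
        = some 1 := by
      have := congrArg (Option.map fun v => g (v ++ [0])) hlast
      rw [← List.getLast?_map] at this
      simpa [hhead, hl1] using this
    rw [hrep 0, List.getLast?_eq_some_getLast (by simp), Option.some.injEq, hr] at hlast'
    -- There are `l.length + 1 = 2 ^ k` blocks, for the lowered `k ≥ 1`: an even number.
    have hodd : (l.length : ZMod 2) = 1 := by
      obtain ⟨j, rfl⟩ : ∃ j, k = j + 1 := ⟨k - 1, by omega⟩
      have : ((l.length + 1 : ℕ) : ZMod 2) = 0 := by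
        rw [hlen, pow_succ, Nat.cast_mul]
        exact mul_eq_zero_of_right _ rfl
      push_cast at this
      generalize (l.length : ZMod 2) = x at this
      revert x; decide
    rw [hodd] at hlast'
    exact absurd hlast' (by decide)

end DeBruijn

/-! ### Single cycles and cycle joining. -/

section Reachability

variable {S : Type*} [Fintype S] {f : S → S}

theorem minimalPeriod_eq_card (h : ∀ x y, ∃ n, f^[n] x = y) (x : S) :
    Function.minimalPeriod f x = Fintype.card S := by
  have hper : x ∈ Function.periodicPts f := by
    obtain ⟨n, hn⟩ := h (f x) x
    exact ⟨n + 1, n.succ_pos, by rw [Function.IsPeriodicPt, Function.IsFixedPt,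
      Function.iterate_succ_apply, hn]⟩
  have hpos := Function.minimalPeriod_pos_of_mem_periodicPts hper
  let φ : Fin (Function.minimalPeriod f x) → S := fun n => f^[n] x
  have hφ : Function.Bijective φ := by
    constructor
    · intro m n hmn
      exact Fin.ext ((Function.iterate_eq_iterate_iff_of_lt_minimalPeriod m.2 n.2).1 hmn)
    · intro y
      obtain ⟨n, rfl⟩ := h x y
      exact ⟨⟨n % _, Nat.mod_lt _ hpos⟩, Function.iterate_mod_minimalPeriod_eq⟩
  simpa using Fintype.card_of_bijective hφ

theorem iterate_eq_iterate_of_forall_lt {T : Type*} {f g : T → T} {x : T} {n : ℕ}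
    (h : ∀ m < n, g (f^[m] x) = f (f^[m] x)) : g^[n] x = f^[n] x := by
  induction n with
  | zero => rfl
  | succ n ih =>
    rw [Function.iterate_succ_apply', ih fun m hm => h m (by omega), h n (by omega),
      Function.iterate_succ_apply']

/-- Joining a fixed point `z` to a cycle that contains all the other states yields one cycle. -/
theorem joinCycles_reachable {T : Type*} [DecidableEq T] {f : T → T} {z u : T} (hz : f z = z)
    (hu : u ≠ z) (hf : ∀ x ≠ z, f x ≠ z) (h : ∀ x ≠ z, ∀ y ≠ z, ∃ n, f^[n] x = y) (x y : T) :
    ∃ n, (joinCycles f z u)^[n] x = y := by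
  have hne : ∀ x ≠ z, ∀ n, f^[n] x ≠ z := by
    intro x hx n
    induction n with
    | zero => exact hx
    | succ n ih => rw [Function.iterate_succ_apply']; exact hf _ ih
  have hjz : joinCycles f z u z = f u := by simp [joinCycles]
  have hju : joinCycles f z u u = z := by simp [joinCycles, hu, hz]
  have hj : ∀ x, x ≠ z → x ≠ u → joinCycles f z u x = f x := by
    intro x h1 h2; simp [joinCycles, h1, h2]
  have hto : ∃ n, (joinCycles f z u)^[n] x = z := by
    by_cases hx : x = z
    · exact ⟨0, hx⟩
    classical
    -- Before the first visit to `u` the joined map agrees with `f`.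
    have hex := h x hx u hu
    refine ⟨Nat.find hex + 1, ?_⟩
    rw [Function.iterate_succ_apply', iterate_eq_iterate_of_forall_lt (f := f), Nat.find_spec hex,
      hju]
    intro m hm
    exact hj _ (hne x hx m) (Nat.find_min hex hm)
  have hfrom : ∃ n, (joinCycles f z u)^[n] z = y := by
    by_cases hy : y = z
    · exact ⟨0, hy.symm⟩
    classical
    have hfu := hf u hu
    have hex := h (f u) hfu y hy
    refine ⟨Nat.find hex + 1, ?_⟩
    rw [Function.iterate_succ_apply, hjz, iterate_eq_iterate_of_forall_lt (f := f),
      Nat.find_spec hex]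
    intro m hm
    -- A visit to `u` at time `m` would restart the orbit at `f u`, so `y` would have been reached
    -- earlier than its first visit.
    refine hj _ (hne _ hfu m) fun he => ?_
    have hspec := Nat.find_spec hex
    rw [show Nat.find hex = (Nat.find hex - (m + 1)) + (m + 1) by omega,
      Function.iterate_add_apply, Function.iterate_succ_apply', he] at hspec
    exact Nat.find_min hex (by omega) hspec
  obtain ⟨a, ha⟩ := hto
  obtain ⟨b, hb⟩ := hfrom
  exact ⟨b + a, by rw [Function.iterate_add_apply, ha, hb]⟩

end Reachability

/-! ### The register of the trinomial and its joined version. -/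

section Register

variable {k : ℕ}

theorem coeff_trinomial2 (j : Fin k) :
    (trinomial2 k).coeff (j : ℕ) = if (j : ℕ) ≤ 1 then 1 else 0 := by
  have := j.2
  simp only [trinomial2, coeff_add, coeff_X_pow, coeff_X, coeff_one]
  split_ifs <;> first | omega | simp

theorem natDegree_trinomial2 (hk : 2 ≤ k) : (trinomial2 k).natDegree = k := by
  unfold trinomial2
  compute_degree!
  all_goals first | omega | skip
  rw [if_neg (by omega), if_neg (by omega)]
  decide

/-- The successor map of a linear-feedback shift register as a linear map. -/
noncomputable def lfsrLinear (k : ℕ) (C : (ZMod 2)[X]) : Module.End (ZMod 2) (RegState k) where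
  toFun := lfsrSucc k C
  map_add' x y := by
    funext i
    simp only [lfsrSucc, Pi.add_apply]
    split
    · rfl
    · simp [mul_add, Finset.sum_add_distrib]
  map_smul' a x := by
    funext i
    simp only [lfsrSucc, Pi.smul_apply, smul_eq_mul, RingHom.id_apply]
    split
    · rfl
    · rw [Finset.mul_sum]
      exact Finset.sum_congr rfl fun j _ => by ring

theorem lfsrLinear_pow_apply (C : (ZMod 2)[X]) (n : ℕ) (x : RegState k) :
    (lfsrLinear k C ^ n) x = (lfsrSucc k C)^[n] x := by
  rw [Module.End.pow_apply]; rfl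

theorem lfsrSucc_trinomial2_last (hk : 2 ≤ k) (x : RegState k) :
    lfsrSucc k (trinomial2 k) x ⟨k - 1, by omega⟩ = x ⟨0, by omega⟩ + x ⟨1, by omega⟩ := by
  simp only [lfsrSucc]
  rw [dif_neg (by omega)]
  simp only [coeff_trinomial2]
  rw [← Finset.sum_subset (Finset.subset_univ {(⟨0, by omega⟩ : Fin k), ⟨1, by omega⟩})]
  · rw [Finset.sum_pair (by simp)]
    simp
  · intro j _ hj
    have : ¬ (j : ℕ) ≤ 1 := by
      simp only [Finset.mem_insert, Finset.mem_singleton, Fin.ext_iff, not_or] at hj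
      omega
    simp [this]

/-- The register maps shift the state by one place. -/
def IsShift (f : RegState k → RegState k) : Prop :=
  ∀ x (i : ℕ) (h : i + 1 < k), f x ⟨i, by omega⟩ = x ⟨i + 1, h⟩

theorem isShift_lfsrSucc (C : (ZMod 2)[X]) : IsShift (lfsrSucc k C) := by
  intro x i h
  simp [lfsrSucc, h]

theorem IsShift.iterate_apply {f : RegState k → RegState k} (hf : IsShift f) (i : ℕ) (h : i < k)
    (x : RegState k) : (f^[i] x) ⟨0, by omega⟩ = x ⟨i, h⟩ := by
  induction i generalizing x with
  | zero => rfl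
  | succ i ih => rw [Function.iterate_succ_apply, ih (by omega), hf x i h]

/-- Coordinate `i` of a state is the first coordinate `i` steps later, so every coordinate reduces
to the feedback rule at time `i`. -/
theorem lfsrLinear_trinomial2_pow_add (hk : 2 ≤ k) :
    lfsrLinear k (trinomial2 k) ^ k + lfsrLinear k (trinomial2 k) + 1 = 0 := by
  set f := lfsrSucc k (trinomial2 k) with hf
  have hs : IsShift f := isShift_lfsrSucc _
  refine LinearMap.ext fun x => funext fun i => ?_
  have h1 : (f^[k] x) i = x i + f x i := by
    obtain ⟨i, hi⟩ := i
    rw [← hs.iterate_apply i hi (f^[k] x), ← hs.iterate_apply i hi x, ← hs.iterate_apply i hi (f x),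
      ← Function.iterate_add_apply, show i + k = (k - 1) + (i + 1) by omega,
      Function.iterate_add_apply, hs.iterate_apply (k - 1) (by omega),
      Function.iterate_succ_apply', hf, lfsrSucc_trinomial2_last hk, ← hf,
      ← hs.iterate_apply 1 (by omega) (f^[i] x), Function.iterate_one,
      ← Function.iterate_succ_apply' f i x, Function.iterate_succ_apply]
  have h2 : lfsrLinear k (trinomial2 k) x = f x := rfl
  simp only [LinearMap.add_apply, Pi.add_apply, lfsrLinear_pow_apply, Module.End.one_apply,
    h2, ← hf, h1, LinearMap.zero_apply, Pi.zero_apply]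
  have h3 : ∀ a b : ZMod 2, a + b + b + a = 0 := by decide
  exact h3 _ _

/-- A nonzero vector is fixed by a power of `A` only if the corresponding power of the root of an
irreducible annihilating polynomial of `A` is `1`. -/
theorem root_pow_eq_one_of_pow_apply_eq {K V : Type*} [Field K] [AddCommGroup V] [Module K V]
    {A : Module.End K V} {C : K[X]} (hC : Irreducible C) (hA : aeval A C = 0) {x : V} (hx : x ≠ 0)
    {n : ℕ} (h : (A ^ n) x = x) : AdjoinRoot.root C ^ n = 1 := by
  by_cases hd : C ∣ X ^ n - 1
  · have := AdjoinRoot.mk_eq_zero.2 hd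
    rwa [map_sub, map_pow, AdjoinRoot.mk_X, map_one, sub_eq_zero] at this
  -- Both terms of this Bézout identity, evaluated at `A`, kill `x`.
  · obtain ⟨a, b, hab⟩ := (hC.coprime_iff_not_dvd).2 hd
    have := congrArg (fun p => aeval A p x) hab
    simp [hA, h] at this
    exact absurd this.symm hx

theorem lfsr_reachable (hk : 2 ≤ k) (hprim : IsPrimitiveBinary (trinomial2 k)) :
    ∀ x ≠ zeroState k, ∀ y ≠ zeroState k, ∃ n, (lfsrSucc k (trinomial2 k))^[n] x = y := by
  classical
  intro x hx y hy
  set A := lfsrLinear k (trinomial2 k) with hA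
  obtain ⟨hirr, hord⟩ := hprim
  rw [natDegree_trinomial2 hk] at hord
  have hpow := lfsrLinear_trinomial2_pow_add hk
  rw [← hA] at hpow
  have hann : aeval A (trinomial2 k) = 0 := by simpa [trinomial2] using hpow
  have hinj : Function.Injective A := by
    rw [injective_iff_map_eq_zero]
    intro v hv
    have := congrArg (fun B : Module.End (ZMod 2) (RegState k) => B v) hpow
    obtain ⟨j, rfl⟩ : ∃ j, k = j + 1 := ⟨k - 1, by omega⟩
    simpa [hv, pow_succ] using this
  have hinjn : ∀ n : ℕ, Function.Injective ⇑(A ^ n) := fun n => by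
    rw [Module.End.coe_pow]; exact hinj.iterate n
  have hord' : ∀ m n, m < n → n < 2 ^ k - 1 → (A ^ m) x ≠ (A ^ n) x := by
    intro m n hmn hn he
    have h1 : (A ^ (n - m)) x = x := by
      apply hinjn m
      rw [← Module.End.mul_apply, ← pow_add, he]
      congr 2
      omega
    have h2 := root_pow_eq_one_of_pow_apply_eq hirr hann hx h1
    have h3 := Nat.le_of_dvd (by omega) (orderOf_dvd_of_pow_eq_one h2)
    omega
  -- The `2 ^ k - 1` distinct iterates of `x` are nonzero, so they are all the nonzero states.
  have himage : (Finset.range (2 ^ k - 1)).image (fun n => (A ^ n) x)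
      = Finset.univ.erase (zeroState k) := by
    apply Finset.eq_of_subset_of_card_le
    · intro z hz
      obtain ⟨n, -, rfl⟩ := Finset.mem_image.1 hz
      refine Finset.mem_erase.2 ⟨fun h0 => hx (hinjn n ?_), Finset.mem_univ _⟩
      rw [h0]
      exact (map_zero (A ^ n)).symm
    · rw [Finset.card_image_of_injOn]
      · simp
      · intro m hm n hn he
        simp only [Finset.coe_range, Set.mem_Iio] at hm hn
        rcases lt_trichotomy m n with h | h | h
        · exact absurd he (hord' m n h hn)
        · exact h
        · exact absurd he.symm (hord' n m h hm)
  have hmem : y ∈ Finset.univ.erase (zeroState k) := by simp [hy]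
  rw [← himage] at hmem
  obtain ⟨n, -, hn⟩ := Finset.mem_image.1 hmem
  exact ⟨n, by rw [← lfsrLinear_pow_apply]; exact hn⟩

/-- The successor map of the joined register. -/
noncomputable def joinedSucc (k : ℕ) : RegState k → RegState k :=
  joinCycles (lfsrSucc k (trinomial2 k)) (zeroState k) (oneZerosState k)

theorem lfsrSucc_zeroState (C : (ZMod 2)[X]) : lfsrSucc k C (zeroState k) = zeroState k :=
  map_zero (lfsrLinear k C)

theorem oneZerosState_ne_zeroState (hk : 0 < k) : oneZerosState k ≠ zeroState k := fun h => by
  simpa [oneZerosState, zeroState] using congrFun h ⟨0, hk⟩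

theorem minimalPeriod_joinedSucc (hk : 2 ≤ k) (hprim : IsPrimitiveBinary (trinomial2 k))
    (x : RegState k) : Function.minimalPeriod (joinedSucc k) x = 2 ^ k := by
  rw [minimalPeriod_eq_card]
  · simp
  refine joinCycles_reachable (lfsrSucc_zeroState _) (oneZerosState_ne_zeroState (by omega)) ?_
    (lfsr_reachable hk hprim)
  intro v hv h0
  have := congrArg (fun B : Module.End (ZMod 2) (RegState k) => B v)
    (lfsrLinear_trinomial2_pow_add hk)
  obtain ⟨j, rfl⟩ : ∃ j, k = j + 1 := ⟨k - 1, by omega⟩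
  have h1 : lfsrLinear (j + 1) (trinomial2 (j + 1)) v = 0 := h0
  have h2 : v = 0 := by simpa [h1, pow_succ] using this
  exact hv h2

theorem isShift_joinedSucc : IsShift (joinedSucc k) := by
  intro x i h
  have hF := isShift_lfsrSucc (k := k) (trinomial2 k)
  rw [joinedSucc, joinCycles]
  split_ifs with h1 h2
  · rw [hF _ _ h, h1]
    simp [oneZerosState, zeroState]
  · rw [hF _ _ h, h2]
    simp [oneZerosState, zeroState]
  · rw [hF _ _ h]

/-- The feedback function of the joined register. -/
theorem joinedSucc_last (hk : 2 ≤ k) (x : RegState k) :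
    joinedSucc k x ⟨k - 1, by omega⟩ = x ⟨0, by omega⟩ +
      if ∀ i : Fin k, 0 < (i : ℕ) → x i = 0 then 1 else x ⟨1, by omega⟩ := by
  have hF := lfsrSucc_trinomial2_last hk
  have hb : ∀ b : ZMod 2, b = 0 ∨ b = 1 := by decide
  by_cases h : ∀ i : Fin k, 0 < (i : ℕ) → x i = 0
  · rw [if_pos h]
    have hx : x = zeroState k ∨ x = oneZerosState k := by
      refine (hb (x ⟨0, by omega⟩)).imp (fun h0 => funext fun i => ?_) fun h0 => funext fun i => ?_
        <;> rcases Nat.eq_zero_or_pos (i : ℕ) with hi | hi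
      · exact (congrArg x (Fin.ext hi)).trans h0
      · exact h i hi
      · rw [oneZerosState, if_pos hi, ← h0]; exact congrArg x (Fin.ext hi)
      · rw [oneZerosState, if_neg hi.ne', h i hi]
    have hne := oneZerosState_ne_zeroState (k := k) (by omega)
    rw [joinedSucc, joinCycles]
    rcases hx with rfl | rfl
    · rw [if_pos rfl, hF]
      simp [oneZerosState, zeroState]
    · rw [if_neg hne, if_pos rfl, hF]
      simp only [oneZerosState, zeroState]
      decide
  · rw [if_neg h, joinedSucc, joinCycles, if_neg, if_neg, hF]
    · rintro rfl
      exact h fun i hi => by simp [oneZerosState, hi.ne']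
    · rintro rfl
      exact h fun i hi => rfl

end Register

/-! ### The preceding letters in lexicographic order. -/

section Pattern

/-- The letter that precedes the window `v` of length `k` in the reversed and complemented joined
sequence. -/
def precedingLetter (k : ℕ) (v : List (ZMod 2)) : ZMod 2 :=
  v.getD (k - 1) 0 + if v.take (k - 1) = List.replicate (k - 1) 1 then 1 else v.getD (k - 2) 0 + 1

theorem precedingLetter_append {j : ℕ} {u : List (ZMod 2)} (hu : u.length = j) (a b : ZMod 2) :
    precedingLetter (j + 2) (u ++ [a] ++ [b]) =
      b + if u = List.replicate j 1 ∧ a = 1 then 1 else a + 1 := by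
  subst hu
  have h : u ++ [a] = List.replicate (u.length + 1) 1 ↔ u = List.replicate u.length 1 ∧ a = 1 := by
    rw [List.replicate_succ']
    refine ⟨fun h => ?_, fun h => by rw [← h.1, h.2]⟩
    have := List.append_inj h (by simp)
    simpa using this
  have htake : (u ++ [a] ++ [b]).take (u.length + 1) = u ++ [a] := by
    rw [List.take_append_of_le_length (by simp), List.take_of_length_le (by simp)]
  simp only [precedingLetter, show u.length + 2 - 1 = u.length + 1 by omega, htake, h]
  simp

/-- Regroups the blocks indexed by the last two letters into the shape of `runMinimalPattern`. -/
theorem replicate_flatten_shift (m : ℕ) :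
    (List.replicate m [(1 : ZMod 2), 0, 0, 1]).flatten ++ [1] =
      1 :: (List.replicate m [(0 : ZMod 2), 0, 1, 1]).flatten := by
  induction m with
  | zero => rfl
  | succ m ih => simp [List.replicate_succ, ih]

theorem map_precedingLetter_binaryWords {k : ℕ} (hk : 2 ≤ k) :
    (binaryWords k).map (precedingLetter k) = runMinimalPattern k := by
  obtain ⟨j, rfl⟩ : ∃ j, k = j + 2 := ⟨k - 2, by omega⟩
  -- Each word of length `j` contributes the four values for its two-letter extensions.
  let q : List (List (ZMod 2)) → List (ZMod 2) := fun l =>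
    ((l.flatMap fun v => [v ++ [0], v ++ [1]]).flatMap fun v => [v ++ [0], v ++ [1]]).map
      (precedingLetter (j + 2))
  have happ : ∀ l l', q (l ++ l') = q l ++ q l' := fun l l' => by simp [q]
  have hblock : ∀ u : List (ZMod 2), u.length = j → u ≠ List.replicate j 1 →
      q [u] = [1, 0, 0, 1] := by
    intro u hu hne
    simp only [q, List.flatMap_cons, List.flatMap_nil, List.append_nil, List.cons_append,
      List.nil_append, List.map_cons, List.map_nil, precedingLetter_append hu, hne, false_and,
      if_false]
    decide
  have hlast : q [List.replicate j 1] = [1, 0, 1, 0] := by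
    simp only [q, List.flatMap_cons, List.flatMap_nil, List.append_nil, List.cons_append,
      List.nil_append, List.map_cons, List.map_nil,
      precedingLetter_append (List.length_replicate (n := j) (a := (1 : ZMod 2))), true_and]
    decide
  have hinit : ∀ l : List (List (ZMod 2)),
      (∀ u ∈ l, u.length = j ∧ u ≠ List.replicate j 1) →
      q l = (List.replicate l.length [1, 0, 0, 1]).flatten := by
    intro l hl
    induction l with
    | nil => rfl
    | cons u l ih =>
      rw [← List.singleton_append, happ, ih fun v hv => hl v (by simp [hv]),
        hblock u (hl u (by simp)).1 (hl u (by simp)).2]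
      simp [List.replicate_succ]
  obtain ⟨l, hl⟩ := exists_binaryWords_eq_append j
  have hnd := nodup_binaryWords j
  have hlen := length_binaryWords j
  rw [hl] at hnd hlen
  have hl' : l.length = 2 ^ j - 1 := by simp at hlen; omega
  change q (binaryWords j) = _
  rw [hl, happ, hlast, hinit l, hl', runMinimalPattern]
  · rw [show [(1 : ZMod 2), 0, 1, 0] = [1] ++ [0, 1, 0] from rfl, ← List.append_assoc,
      replicate_flatten_shift]
    rfl
  · intro u hu
    refine ⟨mem_binaryWords.1 (by rw [hl]; simp [hu]), ?_⟩
    rintro rfl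
    rw [List.nodup_append] at hnd
    exact hnd.2.2 _ hu _ (by simp) rfl

end Pattern

/-! ### The reversed and complemented joined sequence. -/

section WordM

variable {k : ℕ}

/-- The state of the joined register at time `t`. -/
noncomputable def joinedState (x₀ : RegState k) (t : ℕ) : RegState k := (joinedSucc k)^[t] x₀

theorem joinedState_add_apply (x₀ : RegState k) (t i : ℕ) (h : i < k) :
    joinedState x₀ (t + i) ⟨0, by omega⟩ = joinedState x₀ t ⟨i, h⟩ := by
  rw [joinedState, add_comm, Function.iterate_add_apply, isShift_joinedSucc.iterate_apply i h,
    joinedState]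

theorem joinedState_add_two_pow (hk : 2 ≤ k) (hprim : IsPrimitiveBinary (trinomial2 k))
    (x₀ : RegState k) (t : ℕ) : joinedState x₀ (t + 2 ^ k) = joinedState x₀ t := by
  unfold joinedState
  rw [← minimalPeriod_joinedSucc hk hprim x₀, Function.iterate_add_minimalPeriod_eq]

theorem joinedState_eq_iff (hk : 2 ≤ k) (hprim : IsPrimitiveBinary (trinomial2 k))
    (x₀ : RegState k) {s t : ℕ} (h : joinedState x₀ s = joinedState x₀ t) :
    s ≡ t [MOD 2 ^ k] := by
  unfold joinedState at h
  have hm := minimalPeriod_joinedSucc hk hprim x₀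
  rw [← Function.iterate_mod_minimalPeriod_eq (n := s),
    ← Function.iterate_mod_minimalPeriod_eq (n := t)] at h
  rw [← hm]
  have hp : 0 < Function.minimalPeriod (joinedSucc k) x₀ := by rw [hm]; positivity
  exact (Function.iterate_eq_iterate_iff_of_lt_minimalPeriod (Nat.mod_lt _ hp)
    (Nat.mod_lt _ hp)).1 h

theorem length_wordM (hk : 2 ≤ k) (x₀ : RegState k) : (wordM hk x₀).length = 2 ^ k := by
  simp [wordM, complementWord, joinedWord, outputWord]

/-- Times are shifted by a full period so that windows running past the end of the word still have
times in `ℕ`. -/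
theorem wordM_getElem? (hk : 2 ≤ k) (hprim : IsPrimitiveBinary (trinomial2 k)) (x₀ : RegState k)
    {m : ℕ} (hm : m < 2 * 2 ^ k) :
    (wordM hk x₀)[m % (wordM hk x₀).length]? =
      some (joinedState x₀ (2 * 2 ^ k - 1 - m) ⟨0, by omega⟩ + 1) := by
  have hpos : 0 < 2 ^ k := by positivity
  have key : ∀ c < 2 ^ k, (wordM hk x₀)[c]? =
      some (joinedState x₀ (2 ^ k - 1 - c) ⟨0, by omega⟩ + 1) := by
    intro c hc
    simp only [wordM, complementWord, joinedWord, outputWord, List.getElem?_map]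
    rw [List.getElem?_reverse (by simpa using hc), List.length_ofFn, List.getElem?_ofFn,
      dif_pos (by omega)]
    rfl
  rw [length_wordM, key _ (Nat.mod_lt _ hpos)]
  rcases lt_or_ge m (2 ^ k) with h | h
  · rw [Nat.mod_eq_of_lt h, ← joinedState_add_two_pow hk hprim,
      show 2 ^ k - 1 - m + 2 ^ k = 2 * 2 ^ k - 1 - m by omega]
  · rw [Nat.mod_eq_sub_mod h, Nat.mod_eq_of_lt (by omega),
      show 2 ^ k - 1 - (m - 2 ^ k) = 2 * 2 ^ k - 1 - m by omega]

/-- Windows are register states read backwards and complemented, so distinct states give distinct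
windows. -/
theorem wordM_window_getElem? (hk : 2 ≤ k) (hprim : IsPrimitiveBinary (trinomial2 k))
    (x₀ : RegState k) {c : ℕ} (hc : c < 2 ^ k) (i : Fin k) :
    (wordM hk x₀)[(c + (i : ℕ)) % (wordM hk x₀).length]? =
      some (joinedState x₀ (2 * 2 ^ k - c - k) i.rev + 1) := by
  have hlt : k < 2 ^ k := Nat.lt_two_pow_self
  have hi := i.2
  rw [wordM_getElem? hk hprim x₀ (by omega)]
  have := joinedState_add_apply x₀ (2 * 2 ^ k - c - k) i.rev i.rev.2
  rw [← this]
  congr 4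
  rw [Fin.val_rev]
  omega

theorem isDeBruijn_wordM (hk : 2 ≤ k) (hprim : IsPrimitiveBinary (trinomial2 k))
    (x₀ : RegState k) : IsDeBruijn k (wordM hk x₀) := by
  have hlt : k < 2 ^ k := Nat.lt_two_pow_self
  have hlen := length_wordM hk x₀
  refine ⟨by simpa using hlen, fun v => ?_⟩
  let φ : Fin (wordM hk x₀).length → RegState k := fun c i =>
    joinedState x₀ (2 * 2 ^ k - c - k) i.rev + 1
  have hφ : Function.Bijective φ := by
    rw [Fintype.bijective_iff_injective_and_card]
    refine ⟨fun c d hcd => ?_, by simp [hlen]⟩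
    have hc : (c : ℕ) < 2 ^ k := hlen ▸ c.2
    have hd : (d : ℕ) < 2 ^ k := hlen ▸ d.2
    have hst : joinedState x₀ (2 * 2 ^ k - c - k) = joinedState x₀ (2 * 2 ^ k - d - k) := by
      funext i
      simpa [φ] using congrFun hcd i.rev
    -- Adding `c + d + k` clears the truncated subtractions.
    have hmod := (joinedState_eq_iff hk hprim x₀ hst).add_right (c + d + k : ℕ)
    rw [show 2 * 2 ^ k - c - k + (c + d + k : ℕ) = d + 2 * 2 ^ k by omega,
      show 2 * 2 ^ k - d - k + (c + d + k : ℕ) = c + 2 * 2 ^ k by omega] at hmod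
    have := Nat.ModEq.add_right_cancel' _ hmod
    rw [Nat.ModEq, Nat.mod_eq_of_lt hc, Nat.mod_eq_of_lt hd] at this
    exact Fin.ext this.symm
  have hiff : ∀ c : Fin (wordM hk x₀).length,
      (∀ i : Fin k, (wordM hk x₀)[((c : ℕ) + (i : ℕ)) % (wordM hk x₀).length]? = some (v i)) ↔
        φ c = v := by
    intro c
    rw [funext_iff]
    refine forall_congr' fun i => ?_
    rw [wordM_window_getElem? hk hprim x₀ (hlen ▸ c.2), Option.some_inj]
  simp only [hiff]
  exact hφ.existsUnique v

/-- After reversal, the letter before a window is the complement of the next feedback bit. -/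
theorem precedingLetter_ofFn (hk : 2 ≤ k) (y : RegState k) :
    precedingLetter k (List.ofFn fun i => y i.rev + 1) =
      joinedSucc k y ⟨k - 1, by omega⟩ + 1 := by
  have hall : (List.ofFn fun i : Fin k => y i.rev + 1).take (k - 1) = List.replicate (k - 1) 1 ↔
      ∀ i : Fin k, 0 < (i : ℕ) → y i = 0 := by
    constructor
    · intro h i hi
      have := congrArg (fun l => l[(i.rev : ℕ)]?) h
      have hi' := i.2
      have hlt : (i.rev : ℕ) < k - 1 := by rw [Fin.val_rev]; omega
      simp only [List.getElem?_take_of_lt hlt, List.getElem?_ofFn, i.rev.2, dif_pos,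
        List.getElem?_replicate, hlt, if_true, Fin.eta, Fin.rev_rev, Option.some_inj] at this
      simpa using this
    · intro h
      apply List.ext_getElem
      · simp
      · intro i h1 h2
        have h3 : i < k - 1 := by simpa using h2
        simp only [List.getElem_take, List.getElem_ofFn, List.getElem_replicate]
        rw [h _ (by rw [Fin.val_rev]; dsimp only; omega), zero_add]
  have h1 : (List.ofFn fun i : Fin k => y i.rev + 1).getD (k - 1) 0 = y ⟨0, by omega⟩ + 1 := by
    rw [List.getD_eq_getElem _ _ (by simp; omega), List.getElem_ofFn]
    congr 2
    ext
    rw [Fin.val_rev]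
    dsimp only
    omega
  have h2 : (List.ofFn fun i : Fin k => y i.rev + 1).getD (k - 2) 0 = y ⟨1, by omega⟩ + 1 := by
    rw [List.getD_eq_getElem _ _ (by simp; omega), List.getElem_ofFn]
    congr 2
    ext
    rw [Fin.val_rev]
    dsimp only
    omega
  rw [precedingLetter, h1, h2, joinedSucc_last hk]
  simp only [hall]
  have h3 : ∀ a b : ZMod 2, a + 1 + 1 = a + 1 + 1 ∧ a + 1 + (b + 1 + 1) = a + b + 1 := by decide
  split_ifs
  · exact (h3 _ 0).1
  · exact (h3 _ _).2

theorem wordM_getLast?_rotate (hk : 2 ≤ k) (hprim : IsPrimitiveBinary (trinomial2 k))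
    (x₀ : RegState k) (c : ℕ) : ((wordM hk x₀).rotate c).getLast? =
      some (precedingLetter k (cyclicWindow k (wordM hk x₀) c)) := by
  have hlt : k < 2 ^ k := Nat.lt_two_pow_self
  have hlen := length_wordM hk x₀
  wlog hc : c < 2 ^ k generalizing c
  · have := this (c % 2 ^ k) (Nat.mod_lt _ (by positivity))
    rwa [← hlen, List.rotate_mod, cyclicWindow_mod] at this
  rw [(cyclicWindow_eq_iff (by omega) c _).2 (wordM_window_getElem? hk hprim x₀ hc),
    precedingLetter_ofFn hk, List.getLast?_eq_getElem?, List.length_rotate,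
    List.getElem?_rotate (by omega), wordM_getElem? hk hprim x₀ (by omega), hlen]
  have h1 : joinedSucc k (joinedState x₀ (2 * 2 ^ k - c - k)) =
      joinedState x₀ (2 * 2 ^ k - c - k + 1) := (Function.iterate_succ_apply' _ _ _).symm
  rw [h1, ← joinedState_add_apply x₀ _ (k - 1) (by omega),
    ← joinedState_add_two_pow hk hprim x₀ (2 * 2 ^ k - 1 - (2 ^ k - 1 + c))]
  rw [show 2 * 2 ^ k - 1 - (2 ^ k - 1 + c) + 2 ^ k = 2 * 2 ^ k - c - k + 1 + (k - 1) by omega]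

end WordM

/-! ### The main theorem. -/

theorem mainTheorem1 (k : ℕ) (hk : 2 ≤ k) (hprim : IsPrimitiveBinary (trinomial2 k)) :
    -- the seed `x₀` selects the rotation of the cyclic word `M_k`
    (∀ x₀ : RegState k,
      IsDeBruijn k (wordM hk x₀) ∧
      cBWT (wordM hk x₀) = runMinimalPattern k ∧
      numRuns (cBWT (wordM hk x₀)) = 2 ^ (k - 1) + 2) ∧
    -- no binary de Bruijn sequence of order `k` has fewer runs
    (∀ w : List (ZMod 2), IsDeBruijn k w → 2 ^ (k - 1) + 2 ≤ numRuns (cBWT w)) := by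
  refine ⟨fun x₀ => ?_, fun w hw => hw.two_pow_add_two_le_numRuns hk⟩
  have hdb := isDeBruijn_wordM hk hprim x₀
  have hbwt : cBWT (wordM hk x₀) = runMinimalPattern k := by
    rw [hdb.cBWT_eq_map _ (wordM_getLast?_rotate hk hprim x₀), map_precedingLetter_binaryWords hk]
  exact ⟨hdb, hbwt, by rw [hbwt, numRuns_runMinimalPattern hk]⟩
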